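/- Let $d\ge 1$ be an integer, let $\eta\in[0,1]$ and $\theta=1-2\eta$. The broadcast process with parameter $\eta$ on the infinite rooted $d$-ary tree with root $\rho$ is the family of labels $\sigma_u\in\{+,-\}$, indexed by the vertices $u$, in which $\sigma_\rho$ is uniform on $\{+,-\}$ and, going down the tree, independently for each child $v$ of a vertex $u$, $\sigma_v=\sigma_u$ with probability $1-\eta$ and $\sigma_v=-\sigma_u$ with probability $\eta$. For $\delta\in[0,1/2)$ the noisy process $\tau$ is obtained by taking, independently for each vertex $u$, $\tau_u=-\sigma_u$ with probability $\delta$ and $\tau_u=\sigma_u$ otherwise. Let $L_k(\rho)$ be the set of vertices at distance $k$ from $\rho$, and put \[ X_{\rho,k}=\Pr(\sigma_\rho=+\mid\sigma_{L_k(\rho)})-\Pr(\sigma_\rho=-\mid\sigma_{L_k(\rho)}),\qquad Y_{\rho,k}=\Pr(\sigma_\rho=+\mid\tau_{L_k(\rho)})-\Pr(\sigma_\rho=-\mid\tau_{L_k(\rho)}), \] \[ p_{\mathrm{reg}}(d,\eta)=\tfrac12+\lim_{k\to\infty}\mathbb E\left|\Pr(\sigma_\rho=+\mid\sigma_{L_k(\rho)})-\tfrac12\right|,\qquad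 \widetilde p_{\mathrm{reg}}(d,\eta)=\tfrac12+\liminf_{\delta\uparrow 1/2}\,\liminf_{k\to\infty}\mathbb E\left|\Pr(\sigma_\rho=+\mid\tau_{L_k(\rho)})-\tfrac12\right|. \] Theorem. There is an absolute constant $C>0$ such that for all $d$ and $\eta$ with $\theta^2 d>C$ the following hold. (1) For every $\delta\in[0,1/2)$ the limits below exist and \[ \lim_{k\to\infty}\mathbb E|X_{\rho,k}|=\lim_{k\to\infty}\mathbb E|Y_{\rho,k}|. \] (2) The limit defining $p_{\mathrm{reg}}(d,\eta)$ exists, and $\widetilde p_{\mathrm{reg}}(d,\eta)=p_{\mathrm{reg}}(d,\eta)$. -/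

import Mathlib

open MeasureTheory Filter Topology

noncomputable section

namespace TreeBroadcast

/-- The vertices of the infinite rooted `d`-ary tree: finite strings over `{0, …, d-1}`.
The root is the empty string `[]` and the children of `u` are the strings `u ++ [i]`. -/
abbrev Vertex (d : ℕ) : Type := List (Fin d)

/-- `level u k` is `L_k(u)`, the set of descendants of `u` that lie `k` generations below `u`. -/
def level {d : ℕ} (u : Vertex d) (k : ℕ) : Set (Vertex d) :=
  {w | ∃ v : Vertex d, v.length = k ∧ w = u ++ v}

/-- A label `+1` or `-1` at each vertex of the tree. -/
abbrev Labeling (d : ℕ) : Type := Vertex d → ℤˣ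

/-- The number `1/2` as an element of `[0,1]`. -/
def half : unitInterval := ⟨1 / 2, by norm_num, by norm_num⟩

/-- The driving randomness of the broadcast process: independent signs `ε_u`, one for each vertex,
with `P(ε_ρ = -1) = 1/2` at the root and `P(ε_u = -1) = η` at every other vertex `u`, where `ε_u`
records whether the label is flipped along the edge from the parent of `u` to `u`. -/
def broadcastMeasure (d : ℕ) (η : unitInterval) : Measure (Labeling d) :=
  Measure.infinitePi fun u : Vertex d =>
    ProbabilityTheory.bernoulliMeasure (-1 : ℤˣ) 1 (if u = [] then half else η)

/-- The broadcast process `σ`: the label of `u` is the product of the signs `ε_w` over all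
prefixes `w` of `u` (both the root and `u` included). So `σ_ρ = ε_ρ` and
`σ_{ui} = σ_u ε_{ui}`; see `sigma_root` and `sigma_child`. -/
def sigma {d : ℕ} (u : Vertex d) (ε : Labeling d) : ℤˣ :=
  (u.inits.map ε).prod

theorem sigma_root {d : ℕ} (ε : Labeling d) : sigma [] ε = ε [] := by
  simp [sigma]

theorem sigma_child {d : ℕ} (u : Vertex d) (i : Fin d) (ε : Labeling d) :
    sigma (u ++ [i]) ε = sigma u ε * ε (u ++ [i]) := by
  simp [sigma, List.inits_append]

/-- The driving randomness of the noisy broadcast process: the signs `ε` of the broadcast process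
together with an independent family of independent signs `ξ_u`, with `P(ξ_u = -1) = δ`. -/
def noisyMeasure (d : ℕ) (η δ : unitInterval) : Measure (Labeling d × Labeling d) :=
  (broadcastMeasure d η).prod
    (Measure.infinitePi fun _ : Vertex d => ProbabilityTheory.bernoulliMeasure (-1 : ℤˣ) 1 δ)

/-- The noisy broadcast process `τ_u = σ_u ξ_u`. -/
def tau {d : ℕ} (u : Vertex d) (ω : Labeling d × Labeling d) : ℤˣ :=
  sigma u ω.1 * ω.2 u

/-- The conditional probability `P(A | Z)` of the event `A` given an observation `Z` with finitely
many values, as a random variable: at `ω` it is the elementary conditional probability of `A`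
given the event that `Z` takes the value it has at `ω`. -/
def condProb {Ω β : Type*} [MeasurableSpace Ω] (P : Measure Ω) (A : Set Ω) (Z : Ω → β)
    (ω : Ω) : ℝ :=
  (ProbabilityTheory.cond P {ω' | Z ω' = Z ω}).real A

/-- `P(σ_u = s | σ_{L_k(u)})`. -/
def posterior (d : ℕ) (η : unitInterval) (u : Vertex d) (k : ℕ) (s : ℤˣ) :
    Labeling d → ℝ :=
  condProb (broadcastMeasure d η) {ε | sigma u ε = s} fun ε (v : level u k) => sigma v.1 ε

/-- `P(σ_u = s | τ_{L_k(u)})`. -/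
def noisyPosterior (d : ℕ) (η δ : unitInterval) (u : Vertex d) (k : ℕ) (s : ℤˣ) :
    Labeling d × Labeling d → ℝ :=
  condProb (noisyMeasure d η δ) {ω | sigma u ω.1 = s} fun ω (v : level u k) => tau v.1 ω

/-- The magnetization `X_{u,k}` of `u` given the exact labels on `L_k(u)`. -/
def X (d : ℕ) (η : unitInterval) (u : Vertex d) (k : ℕ) (ε : Labeling d) : ℝ :=
  posterior d η u k 1 ε - posterior d η u k (-1) ε

/-- The noisy magnetization `Y_{u,k}` of `u` given the noisy labels on `L_k(u)`. -/
def Y (d : ℕ) (η δ : unitInterval) (u : Vertex d) (k : ℕ) (ω : Labeling d × Labeling d) : ℝ :=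
  noisyPosterior d η δ u k 1 ω - noisyPosterior d η δ u k (-1) ω

/-- `p_reg(d, η) = 1/2 + lim_k E |P(σ_ρ = + | σ_{L_k(ρ)}) - 1/2|`. -/
def pReg (d : ℕ) (η : unitInterval) : ℝ :=
  1 / 2 + limUnder atTop fun k : ℕ =>
    ∫ ε, |posterior d η [] k 1 ε - 1 / 2| ∂(broadcastMeasure d η)

/-- `p̃_reg(d, η) = 1/2 + liminf_{δ → 1/2} liminf_k E |P(σ_ρ = + | τ_{L_k(ρ)}) - 1/2|`, where `δ`
tends to `1/2` from below. -/
def pRobustReg (d : ℕ) (η : unitInterval) : ℝ :=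
  1 / 2 + liminf (fun δ : unitInterval =>
    liminf (fun k : ℕ =>
      ∫ ω, |noisyPosterior d η δ [] k 1 ω - 1 / 2| ∂(noisyMeasure d η δ)) atTop) (𝓝[<] half)

end TreeBroadcast

end

/-! The noisy labels of level `k` are the output of a binary-input channel `chan d η δ k`. It starts
as a binary symmetric channel with noise `δ`; each further level precomposes an edge (`edge`) and
takes `d` conditionally independent copies (`tensor`). Under a uniform root, `E|X|` and `E|Y|` are
the total variation distances `tv` for noise `0` and `δ`. The noisy channel is a degradation of the
exact one, so averages of convex functions of the posterior mean can only drop (`Degraded.avg_le`);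
the comparisons of the two channels come from choosing the convex function.

The gap is measured by the Bhattacharyya coefficient, which is multiplicative over independent
copies. Convexity of `√(1-θ²x²) - θ²√(1-x²)` shows that an edge shrinks the gap by `θ²`, while `d`
copies expand it by at most `d B^(d-1)`, with `B` the noisy coefficient after the edge. When `θ²d`
is large, one minus the noisy coefficient doubles at each level until the coefficient is at most
`1/2` (`eventually_bhatt_chan_le`). From then on `B ≤ 1 - θ²/4`, hence `θ² d B^(d-1) ≤ 1/2`
(`contraction_factor_le`), and the gap decays geometrically.

One more convex function turns this into a vanishing gap in `tv` (`Degraded.tv_le_add`). The exact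
`tv` decreases in `k`, so both limits exist and agree for every `δ < 1/2`; the liminf over `δ` is
then that of a constant. -/

noncomputable section

namespace TreeBroadcast

/-! ### Binary-input channels, degradation and averages of the posterior mean. -/

section Channel

variable {T T' : Type*} [Fintype T] [Fintype T']

/-- The transition matrix of a channel with binary input. -/
structure IsChannel (p : ℤˣ → T → ℝ) : Prop where
  nonneg : ∀ s t, 0 ≤ p s t
  sum_eq_one : ∀ s, ∑ t, p s t = 1

/-- `q` is obtained from `p` by passing the output of `p` through a stochastic kernel. -/
def Degraded (p : ℤˣ → T → ℝ) (q : ℤˣ → T' → ℝ) : Prop :=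
  ∃ N : T → T' → ℝ, (∀ t t', 0 ≤ N t t') ∧ (∀ t, ∑ t', N t t' = 1) ∧
    ∀ s t', q s t' = ∑ t, p s t * N t t'

/-- The output law of a channel under a uniform input. -/
def mass (p : ℤˣ → T → ℝ) (t : T) : ℝ := (p 1 t + p (-1) t) / 2

/-- The posterior mean of a uniform input. -/
def mag (p : ℤˣ → T → ℝ) (t : T) : ℝ := (p 1 t - p (-1) t) / (p 1 t + p (-1) t)

/-- The expectation of a function of the posterior mean. -/
def avg (f : ℝ → ℝ) (p : ℤˣ → T → ℝ) : ℝ := ∑ t, mass p t * f (mag p t)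

/-- The Bhattacharyya coefficient. -/
def bhatt (p : ℤˣ → T → ℝ) : ℝ := ∑ t, √(p 1 t * p (-1) t)

/-- The total variation distance between the two output laws. -/
def tv (p : ℤˣ → T → ℝ) : ℝ := ∑ t, |p 1 t - p (-1) t| / 2

/-- The law of a sign that is `-1` with probability `η`. -/
def signLaw (η : ℝ) (e : ℤˣ) : ℝ := if e = -1 then η else 1 - η

/-- Precomposition with the binary symmetric channel with crossover probability `η`. -/
def edge (η : ℝ) (p : ℤˣ → T → ℝ) (s : ℤˣ) (t : T) : ℝ := ∑ e, signLaw η e * p (s * e) t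

/-- `d` conditionally independent uses of a channel with the same input. -/
def tensor (d : ℕ) (p : ℤˣ → T → ℝ) (s : ℤˣ) (t : Fin d → T) : ℝ := ∏ i, p s (t i)

theorem sum_units_int (f : ℤˣ → ℝ) : ∑ e, f e = f 1 + f (-1) := by
  have : (Finset.univ : Finset ℤˣ) = {1, -1} := by decide
  rw [this, Finset.sum_pair (by decide)]

theorem sum_signLaw (η : ℝ) : ∑ e, signLaw η e = 1 := by
  rw [sum_units_int]; simp [signLaw]

theorem signLaw_nonneg {η : ℝ} (h0 : 0 ≤ η) (h1 : η ≤ 1) (e : ℤˣ) : 0 ≤ signLaw η e := by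
  unfold signLaw; split_ifs <;> linarith

theorem edge_eq {S : Type*} (η : ℝ) (p : ℤˣ → S → ℝ) (s : ℤˣ) (t : S) :
    edge η p s t = (1 - η) * p s t + η * p (-s) t := by
  rw [edge, sum_units_int]; simp [signLaw]

theorem sum_pi_prod {d : ℕ} (g : Fin d → T → ℝ) :
    ∑ t : Fin d → T, ∏ i, g i (t i) = ∏ i, ∑ t, g i t := by
  classical
  rw [Finset.prod_univ_sum, Fintype.piFinset_univ]

theorem IsChannel.edge {p : ℤˣ → T → ℝ} (hp : IsChannel p) {η : ℝ} (h0 : 0 ≤ η) (h1 : η ≤ 1) :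
    IsChannel (edge η p) where
  nonneg s t := Finset.sum_nonneg fun e _ => mul_nonneg (signLaw_nonneg h0 h1 e) (hp.nonneg _ _)
  sum_eq_one s := by
    simp_rw [edge_eq, Finset.sum_add_distrib, ← Finset.mul_sum, hp.sum_eq_one]; ring

theorem IsChannel.tensor {p : ℤˣ → T → ℝ} (hp : IsChannel p) (d : ℕ) :
    IsChannel (tensor d p) where
  nonneg s t := Finset.prod_nonneg fun i _ => hp.nonneg _ _
  sum_eq_one s := by
    simp only [TreeBroadcast.tensor]
    rw [sum_pi_prod (fun _ => p s)]; simp [hp.sum_eq_one]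

theorem Degraded.edge {p : ℤˣ → T → ℝ} {q : ℤˣ → T' → ℝ} (h : Degraded p q) (η : ℝ) :
    Degraded (edge η p) (edge η q) := by
  obtain ⟨N, hN0, hN1, hN⟩ := h
  refine ⟨N, hN0, hN1, fun s t' => ?_⟩
  simp_rw [edge_eq, hN, Finset.mul_sum, ← Finset.sum_add_distrib]
  exact Finset.sum_congr rfl fun t _ => by ring

theorem Degraded.tensor {p : ℤˣ → T → ℝ} {q : ℤˣ → T' → ℝ} (h : Degraded p q) (d : ℕ) :
    Degraded (tensor d p) (tensor d q) := by
  obtain ⟨N, hN0, hN1, hN⟩ := h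
  refine ⟨fun t t' => ∏ i, N (t i) (t' i), fun t t' => Finset.prod_nonneg fun i _ => hN0 _ _,
    fun t => ?_, fun s t' => ?_⟩
  · rw [sum_pi_prod (fun i => N (t i))]; simp [hN1]
  · simp only [TreeBroadcast.tensor, hN, ← Finset.prod_mul_distrib]
    rw [sum_pi_prod (fun i t => p s t * N t (t' i))]

/-- The square root of a product factorizes. Total variation has no such formula, which is why the
gap is tracked with this coefficient. -/
theorem bhatt_tensor {p : ℤˣ → T → ℝ} (hp : IsChannel p) (d : ℕ) :
    bhatt (tensor d p) = bhatt p ^ d := by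
  simp only [bhatt, tensor, ← Finset.prod_mul_distrib]
  simp_rw [Real.sqrt_prod _ fun i _ => mul_nonneg (hp.nonneg _ _) (hp.nonneg _ _)]
  rw [sum_pi_prod (fun _ t => √(p 1 t * p (-1) t))]
  simp

theorem bhatt_nonneg (p : ℤˣ → T → ℝ) : 0 ≤ bhatt p :=
  Finset.sum_nonneg fun _ _ => Real.sqrt_nonneg _

theorem mass_nonneg {p : ℤˣ → T → ℝ} (hp : IsChannel p) (t : T) : 0 ≤ mass p t := by
  have := hp.nonneg 1 t; have := hp.nonneg (-1) t
  unfold mass; linarith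

theorem sum_mass {p : ℤˣ → T → ℝ} (hp : IsChannel p) : ∑ t, mass p t = 1 := by
  simp only [mass, ← Finset.sum_div, Finset.sum_add_distrib, hp.sum_eq_one]; norm_num

theorem mass_mul_mag {p : ℤˣ → T → ℝ} (hp : IsChannel p) (t : T) :
    mass p t * mag p t = (p 1 t - p (-1) t) / 2 := by
  have h1 := hp.nonneg 1 t
  have h2 := hp.nonneg (-1) t
  unfold mass mag
  rcases eq_or_ne (p 1 t + p (-1) t) 0 with h | h
  -- A null output has both entries zero, so the default value of the quotient in `mag` is harmless.
  · have : p 1 t = 0 := by linarith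
    have : p (-1) t = 0 := by linarith
    simp [*]
  · field_simp

theorem mag_mem {p : ℤˣ → T → ℝ} (hp : IsChannel p) (t : T) : mag p t ∈ Set.Icc (-1 : ℝ) 1 := by
  have h1 := hp.nonneg 1 t
  have h2 := hp.nonneg (-1) t
  rw [Set.mem_Icc, ← abs_le, mag, abs_div, abs_of_nonneg (add_nonneg h1 h2)]
  exact div_le_one_of_le₀ (abs_le.2 ⟨by linarith, by linarith⟩) (by linarith)

theorem bhatt_eq_avg {p : ℤˣ → T → ℝ} (hp : IsChannel p) :
    bhatt p = avg (fun x => √(1 - x ^ 2)) p := by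
  refine Finset.sum_congr rfl fun t _ => ?_
  have hm := mass_nonneg hp t
  rw [← Real.sqrt_sq hm, ← Real.sqrt_mul (sq_nonneg _), mul_sub, ← mul_pow, mass_mul_mag hp, mass]
  congr 1; ring

theorem tv_eq_avg {p : ℤˣ → T → ℝ} (hp : IsChannel p) : tv p = avg (fun x => |x|) p := by
  refine Finset.sum_congr rfl fun t _ => ?_
  have hm := mass_nonneg hp t
  rw [← abs_of_nonneg hm, ← abs_mul, mass_mul_mag hp, abs_div, abs_two]

/-- A symmetric flip of the input keeps the output law and multiplies the posterior mean by `θ = 1 -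
2η`. -/
theorem avg_edge (f : ℝ → ℝ) (p : ℤˣ → T → ℝ) (η : ℝ) :
    avg f (edge η p) = avg (fun x => f ((1 - 2 * η) * x)) p := by
  refine Finset.sum_congr rfl fun t _ => ?_
  have h : edge η p 1 t + edge η p (-1) t = p 1 t + p (-1) t := by
    simp only [edge_eq, neg_neg]; ring
  have h' : edge η p 1 t - edge η p (-1) t = (1 - 2 * η) * (p 1 t - p (-1) t) := by
    simp only [edge_eq, neg_neg]; ring
  rw [mass, mag, h, h', mul_div_assoc]; rfl

theorem avg_mono {p : ℤˣ → T → ℝ} (hp : IsChannel p) {f g : ℝ → ℝ}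
    (h : ∀ x ∈ Set.Icc (-1 : ℝ) 1, f x ≤ g x) : avg f p ≤ avg g p :=
  Finset.sum_le_sum fun t _ => mul_le_mul_of_nonneg_left (h _ (mag_mem hp t)) (mass_nonneg hp t)

theorem avg_linear (f g : ℝ → ℝ) (a b : ℝ) (p : ℤˣ → T → ℝ) :
    avg (fun x => a * f x + b * g x) p = a * avg f p + b * avg g p := by
  simp only [avg, Finset.mul_sum, ← Finset.sum_add_distrib]
  exact Finset.sum_congr rfl fun t _ => by ring

theorem avg_one {p : ℤˣ → T → ℝ} (hp : IsChannel p) : avg (fun _ => 1) p = 1 := by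
  simp [avg, sum_mass hp]

/-- Jensen's inequality for degradations. -/
theorem Degraded.avg_le {p : ℤˣ → T → ℝ} {q : ℤˣ → T' → ℝ} (h : Degraded p q)
    (hp : IsChannel p) (hq : IsChannel q) {f : ℝ → ℝ} (hf : ConvexOn ℝ (Set.Icc (-1) 1) f) :
    avg f q ≤ avg f p := by
  obtain ⟨N, hN0, hN1, hN⟩ := h
  have key : ∀ t', mass q t' * f (mag q t') ≤ ∑ t, mass p t * N t t' * f (mag p t) := by
    intro t'
    have hmass : mass q t' = ∑ t, mass p t * N t t' := by
      simp only [mass, hN, ← Finset.sum_add_distrib, Finset.sum_div]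
      exact Finset.sum_congr rfl fun t _ => by ring
    have hw : ∀ t, 0 ≤ mass p t * N t t' := fun t => mul_nonneg (mass_nonneg hp t) (hN0 _ _)
    rcases (mass_nonneg hq t').eq_or_lt with h0 | hpos
    · rw [hmass, eq_comm, Finset.sum_eq_zero_iff_of_nonneg fun t _ => hw t] at h0
      rw [hmass, Finset.sum_eq_zero h0, zero_mul]
      exact (Finset.sum_eq_zero fun t ht => by rw [h0 t ht, zero_mul]).ge
    -- Tower property: the weights are the conditional law of the output of `p` given the output
    -- `t'` of `q`.
    · have hmag : mag q t' = ∑ t, (mass p t * N t t' / mass q t') * mag p t := by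
        apply mul_left_cancel₀ hpos.ne'
        rw [mass_mul_mag hq, hN, hN, ← Finset.sum_sub_distrib, Finset.sum_div, Finset.mul_sum]
        refine Finset.sum_congr rfl fun t _ => ?_
        have := mass_mul_mag hp t
        field_simp
        linear_combination (-2 * N t t') * this
      have hJ := hf.map_sum_le (t := Finset.univ) (w := fun t => mass p t * N t t' / mass q t')
        (p := mag p) (fun t _ => div_nonneg (hw t) hpos.le)
        (by rw [← Finset.sum_div, ← hmass, div_self hpos.ne']) (fun t _ => mag_mem hp t)
      simp only [smul_eq_mul] at hJ
      rw [← hmag] at hJ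
      refine (mul_le_mul_of_nonneg_left hJ hpos.le).trans_eq ?_
      rw [Finset.mul_sum]
      exact Finset.sum_congr rfl fun t _ => by field_simp
  refine (Finset.sum_le_sum fun t' _ => key t').trans_eq ?_
  rw [Finset.sum_comm]
  refine Finset.sum_congr rfl fun t _ => ?_
  rw [← Finset.sum_mul, ← Finset.mul_sum, hN1, mul_one]

end Channel

/-! ### Convexity by second derivatives. -/

theorem hasDerivAt_sqrt_add_mul_sq {a b x : ℝ} (h : 0 < a + b * x ^ 2) :
    HasDerivAt (fun x => √(a + b * x ^ 2)) (b * x / √(a + b * x ^ 2)) x := by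
  have h1 : HasDerivAt (fun x => a + b * x ^ 2) (b * (2 * x)) x := by
    simpa using ((hasDerivAt_pow 2 x).const_mul b).const_add a
  convert h1.sqrt h.ne' using 1
  have := Real.sqrt_pos.2 h
  field_simp

theorem hasDerivAt_mul_div_sqrt {a b x : ℝ} (h : 0 < a + b * x ^ 2) :
    HasDerivAt (fun x => b * x / √(a + b * x ^ 2)) (a * b / √(a + b * x ^ 2) ^ 3) x := by
  have h1 : HasDerivAt (fun x => b * x) b x := by
    simpa using (hasDerivAt_id x).const_mul b
  have hs := Real.sqrt_pos.2 h
  refine (h1.fun_div (hasDerivAt_sqrt_add_mul_sq h) hs.ne').congr_deriv ?_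
  have h2 := Real.sq_sqrt h.le
  field_simp
  rw [h2]; ring

/-- Common form of the three functions below, using `(√(a + b x²))'' = a b / (a + b x²)^(3/2)`. -/
theorem convexOn_sqrt_add_sqrt {A B a b a' b' : ℝ}
    (h : ∀ x : ℝ, x ^ 2 < 1 → 0 < a + b * x ^ 2) (h' : ∀ x : ℝ, x ^ 2 < 1 → 0 < a' + b' * x ^ 2)
    (hsec : ∀ x : ℝ, x ^ 2 < 1 → 0 ≤ A * (a * b / √(a + b * x ^ 2) ^ 3) +
      B * (a' * b' / √(a' + b' * x ^ 2) ^ 3)) :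
    ConvexOn ℝ (Set.Icc (-1) 1) fun x => A * √(a + b * x ^ 2) + B * √(a' + b' * x ^ 2) := by
  have hint : ∀ x ∈ interior (Set.Icc (-1 : ℝ) 1), x ^ 2 < 1 := by
    intro x hx
    rw [interior_Icc] at hx
    rw [sq_lt_one_iff_abs_lt_one, abs_lt]; exact hx
  refine convexOn_of_hasDerivWithinAt2_nonneg (convex_Icc _ _) (by fun_prop)
    (f' := fun x => A * (b * x / √(a + b * x ^ 2)) + B * (b' * x / √(a' + b' * x ^ 2)))
    (f'' := fun x => A * (a * b / √(a + b * x ^ 2) ^ 3) +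
      B * (a' * b' / √(a' + b' * x ^ 2) ^ 3)) ?_ ?_ fun x hx => hsec x (hint x hx)
  · intro x hx
    exact (((hasDerivAt_sqrt_add_mul_sq (h x (hint x hx))).const_mul A).add
      ((hasDerivAt_sqrt_add_mul_sq (h' x (hint x hx))).const_mul B)).hasDerivWithinAt
  · intro x hx
    exact (((hasDerivAt_mul_div_sqrt (h x (hint x hx))).const_mul A).add
      ((hasDerivAt_mul_div_sqrt (h' x (hint x hx))).const_mul B)).hasDerivWithinAt

/-- The padding `+ 0 * 1` gives the shape that `avg_linear` rewrites. -/
theorem convexOn_bhatt : ConvexOn ℝ (Set.Icc (-1) 1) fun x : ℝ => (-1) * √(1 - x ^ 2) + 0 * 1 := by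
  have h : ∀ x : ℝ, x ^ 2 < 1 → 0 < 1 + (-1) * x ^ 2 := fun x hx => by linarith
  have := convexOn_sqrt_add_sqrt (A := -1) (B := 0) h h fun x hx => by
    have := Real.sqrt_pos.2 (h x hx)
    simp only [mul_neg, mul_one, neg_mul, one_mul, zero_mul, neg_div, neg_neg]
    simp only [neg_mul, one_mul] at this
    positivity
  convert this using 3 <;> ring_nf

/-- The loss in Bhattacharyya coefficient contracts by `θ ^ 2` along an edge. -/
theorem convexOn_edge {θ : ℝ} (hθ : θ ^ 2 ≤ 1) :
    ConvexOn ℝ (Set.Icc (-1) 1) fun x : ℝ => 1 * √(1 - (θ * x) ^ 2) + (-θ ^ 2) * √(1 - x ^ 2) := by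
  have h : ∀ x : ℝ, x ^ 2 < 1 → 0 < 1 + (-1) * x ^ 2 := fun x hx => by linarith
  have hle : ∀ x : ℝ, 1 + (-1) * x ^ 2 ≤ 1 + (-θ ^ 2) * x ^ 2 := fun x => by
    nlinarith [sq_nonneg x]
  have := convexOn_sqrt_add_sqrt (A := 1) (B := -θ ^ 2)
    (fun x hx => (h x hx).trans_le (hle x)) h fun x hx => by
    have h1 := Real.sqrt_pos.2 (h x hx)
    have h2 := Real.sqrt_le_sqrt (hle x)
    -- The second derivative is `θ²` times the difference of these two terms.
    have h3 : 1 / √(1 + (-θ ^ 2) * x ^ 2) ^ 3 ≤ 1 / √(1 + (-1) * x ^ 2) ^ 3 :=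
      one_div_le_one_div_of_le (by positivity) (by gcongr)
    have h4 := mul_le_mul_of_nonneg_left h3 (sq_nonneg θ)
    calc (0 : ℝ) ≤ θ ^ 2 * (1 / √(1 + (-1) * x ^ 2) ^ 3) -
          θ ^ 2 * (1 / √(1 + (-θ ^ 2) * x ^ 2) ^ 3) := sub_nonneg.2 h4
      _ = _ := by ring
  convert this using 3 <;> ring_nf

/-- `√(ε² + x²)` smooths `|x|` and has second derivative at most `1/ε`, while that of `-√(1-x²)` is
at least `1`; the weight `1/ε` makes the latter dominate. -/
theorem convexOn_tv {ε : ℝ} (hε : 0 < ε) :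
    ConvexOn ℝ (Set.Icc (-1) 1)
      fun x : ℝ => (-(1 / ε)) * √(1 - x ^ 2) + (-1) * √(ε ^ 2 + x ^ 2) := by
  have h : ∀ x : ℝ, x ^ 2 < 1 → 0 < 1 + (-1) * x ^ 2 := fun x hx => by linarith
  have h' : ∀ x : ℝ, x ^ 2 < 1 → 0 < ε ^ 2 + 1 * x ^ 2 := fun x _ => by positivity
  have := convexOn_sqrt_add_sqrt (A := -(1 / ε)) (B := -1) h h' fun x hx => by
    have h1 := Real.sqrt_pos.2 (h x hx)
    have h2 : √(1 + (-1) * x ^ 2) ≤ 1 := Real.sqrt_le_one.2 (by nlinarith [sq_nonneg x])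
    have h3 : ε ≤ √(ε ^ 2 + 1 * x ^ 2) := Real.le_sqrt_of_sq_le (by nlinarith [sq_nonneg x])
    have h4 : 1 ≤ 1 / √(1 + (-1) * x ^ 2) ^ 3 :=
      (one_le_div (by positivity)).2 (pow_le_one₀ h1.le h2)
    have h5 : ε ^ 2 / √(ε ^ 2 + 1 * x ^ 2) ^ 3 ≤ ε ^ 2 / ε ^ 3 := by gcongr
    have h6 : ε ^ 2 / ε ^ 3 = 1 / ε := by field_simp
    have h7 : 1 / ε * 1 ≤ 1 / ε * (1 / √(1 + (-1) * x ^ 2) ^ 3) := by gcongr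
    calc (0 : ℝ) ≤ 1 / ε * (1 / √(1 + (-1) * x ^ 2) ^ 3) -
          ε ^ 2 / √(ε ^ 2 + 1 * x ^ 2) ^ 3 := by linarith
      _ = _ := by ring
  convert this using 3 <;> ring_nf

/-! ### Inequalities for `bhatt` and `tv` under degradation and edges. -/

section Channel

variable {T T' : Type*} [Fintype T] [Fintype T']

theorem Degraded.tv_le {p : ℤˣ → T → ℝ} {q : ℤˣ → T' → ℝ} (h : Degraded p q)
    (hp : IsChannel p) (hq : IsChannel q) : tv q ≤ tv p := by
  rw [tv_eq_avg hp, tv_eq_avg hq]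
  exact h.avg_le hp hq ((convexOn_norm (convex_Icc (-1 : ℝ) 1)).congr fun x _ => rfl)

theorem Degraded.bhatt_le {p : ℤˣ → T → ℝ} {q : ℤˣ → T' → ℝ} (h : Degraded p q)
    (hp : IsChannel p) (hq : IsChannel q) : bhatt p ≤ bhatt q := by
  have := h.avg_le hp hq convexOn_bhatt
  rw [avg_linear, avg_linear, ← bhatt_eq_avg hp, ← bhatt_eq_avg hq] at this
  linarith

theorem bhatt_edge {p : ℤˣ → T → ℝ} (hp : IsChannel p) {η : ℝ} (h0 : 0 ≤ η) (h1 : η ≤ 1) :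
    bhatt (edge η p) = avg (fun x => √(1 - ((1 - 2 * η) * x) ^ 2)) p := by
  rw [bhatt_eq_avg (hp.edge h0 h1), avg_edge]

theorem Degraded.bhatt_edge_sub_le {p : ℤˣ → T → ℝ} {q : ℤˣ → T' → ℝ} (h : Degraded p q)
    (hp : IsChannel p) (hq : IsChannel q) {η : ℝ} (h0 : 0 ≤ η) (h1 : η ≤ 1) :
    bhatt (TreeBroadcast.edge η q) - bhatt (TreeBroadcast.edge η p) ≤
      (1 - 2 * η) ^ 2 * (bhatt q - bhatt p) := by
  have := h.avg_le hp hq (convexOn_edge (θ := 1 - 2 * η) (by nlinarith))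
  rw [avg_linear, avg_linear, ← bhatt_eq_avg hp, ← bhatt_eq_avg hq, ← bhatt_edge hp h0 h1,
    ← bhatt_edge hq h0 h1] at this
  linarith

/-- Pointwise, with `w = √(1-x²)`: `1 - θ²(1-w²) ≤ (1 - θ²(1-w)/2)²`, because `1 - w² ≥ 1 - w`. -/
theorem bhatt_edge_le {p : ℤˣ → T → ℝ} (hp : IsChannel p) {η : ℝ} (h0 : 0 ≤ η) (h1 : η ≤ 1) :
    bhatt (edge η p) ≤ 1 - (1 - 2 * η) ^ 2 / 2 * (1 - bhatt p) := by
  set θ := 1 - 2 * η with hθ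
  have hθ1 : θ ^ 2 ≤ 1 := by nlinarith
  have : avg (fun x => √(1 - (θ * x) ^ 2)) p ≤
      avg (fun x => (1 - θ ^ 2 / 2) * 1 + θ ^ 2 / 2 * √(1 - x ^ 2)) p := by
    refine avg_mono hp fun x hx => ?_
    have hx2 : x ^ 2 ≤ 1 := by rw [sq_le_one_iff_abs_le_one, abs_le]; exact hx
    have hw := Real.sq_sqrt (sub_nonneg.2 hx2)
    have hw0 := Real.sqrt_nonneg (1 - x ^ 2)
    have hw1 : √(1 - x ^ 2) ≤ 1 := Real.sqrt_le_one.2 (by nlinarith [sq_nonneg x])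
    set w := √(1 - x ^ 2)
    refine Real.sqrt_le_iff.2 ⟨by nlinarith [sq_nonneg θ, mul_nonneg (sq_nonneg θ) hw0], ?_⟩
    have e : 1 - (θ * x) ^ 2 = 1 - θ ^ 2 * (1 - w ^ 2) := by rw [hw]; ring
    rw [e]
    nlinarith [mul_nonneg (mul_nonneg (sq_nonneg θ) hw0) (sub_nonneg.2 hw1),
      sq_nonneg (θ ^ 2 * (1 - w))]
  rw [avg_linear (fun _ => 1), avg_one hp, ← bhatt_eq_avg hp, ← bhatt_edge hp h0 h1] at this
  linarith

theorem bhatt_le_one {p : ℤˣ → T → ℝ} (hp : IsChannel p) : bhatt p ≤ 1 := by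
  rw [bhatt_eq_avg hp]
  refine (avg_mono hp (g := fun _ => 1) fun x _ => ?_).trans_eq (avg_one hp)
  exact Real.sqrt_le_one.2 (by nlinarith [sq_nonneg x])

/-- Quantitative converse to `Degraded.tv_le`: a small Bhattacharyya gap forces a small total
variation gap. The additive `ε` is the cost of smoothing `|x|`. -/
theorem Degraded.tv_le_add {p : ℤˣ → T → ℝ} {q : ℤˣ → T' → ℝ} (h : Degraded p q)
    (hp : IsChannel p) (hq : IsChannel q) {ε : ℝ} (hε : 0 < ε) :
    tv p ≤ tv q + ε + 1 / ε * (bhatt q - bhatt p) := by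
  have := h.avg_le hp hq (convexOn_tv hε)
  rw [avg_linear, avg_linear, ← bhatt_eq_avg hp, ← bhatt_eq_avg hq] at this
  have h1 : tv p ≤ avg (fun x => √(ε ^ 2 + x ^ 2)) p := by
    rw [tv_eq_avg hp]
    exact avg_mono hp fun x _ => Real.abs_le_sqrt (by nlinarith [sq_nonneg ε])
  have h2 : avg (fun x => √(ε ^ 2 + x ^ 2)) q ≤ tv q + ε := by
    have : avg (fun x => √(ε ^ 2 + x ^ 2)) q ≤ avg (fun x => 1 * |x| + ε * 1) q :=
      avg_mono hq fun x _ => Real.sqrt_le_iff.2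
        ⟨by positivity, by nlinarith [sq_abs x, abs_nonneg x, mul_nonneg hε.le (abs_nonneg x)]⟩
    rw [avg_linear (fun x => |x|) (fun _ => 1), avg_one hq, ← tv_eq_avg hq] at this
    linarith
  linarith

end Channel

/-! ### The channels of the tree and the contraction of their gap. -/

/-- The possible labelings of the `k`-th level of the tree. -/
def Obs (d : ℕ) : ℕ → Type
  | 0 => ℤˣ
  | k + 1 => Fin d → Obs d k

instance instFintypeObs (d : ℕ) : ∀ k, Fintype (Obs d k)
  | 0 => inferInstanceAs (Fintype ℤˣ)
  | k + 1 =>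
    haveI := instFintypeObs d k
    haveI : DecidableEq (Fin d) := inferInstance
    inferInstanceAs (Fintype (Fin d → Obs d k))

/-- The channel from the label of the root to the noisy labels of the `k`-th level. -/
def chan (d : ℕ) (η δ : ℝ) : ∀ k, ℤˣ → Obs d k → ℝ
  | 0 => fun s (t : ℤˣ) => signLaw δ (s * t)
  | k + 1 => tensor d (edge η (chan d η δ k))

theorem sum_signLaw_mul (δ : ℝ) (s : ℤˣ) : ∑ t, signLaw δ (s * t) = 1 := by
  rw [← sum_signLaw δ]
  exact Fintype.sum_equiv (Equiv.mulLeft s) _ _ fun t => rfl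

section Dynamics

variable {d : ℕ} {η δ : ℝ}

theorem isChannel_chan (hη0 : 0 ≤ η) (hη1 : η ≤ 1) (hδ0 : 0 ≤ δ) (hδ1 : δ ≤ 1) :
    ∀ k, IsChannel (chan d η δ k)
  | 0 => ⟨fun _ _ => signLaw_nonneg hδ0 hδ1 _, sum_signLaw_mul δ⟩
  | k + 1 => ((isChannel_chan hη0 hη1 hδ0 hδ1 k).edge hη0 hη1).tensor d

/-- Without noise, level `0` reveals the input, so `p` itself serves as the kernel. -/
theorem degraded_chan_zero {T : Type*} [Fintype T] {p : ℤˣ → T → ℝ} (hp : IsChannel p) :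
    Degraded (chan d η 0 0) p := by
  refine ⟨p, hp.nonneg, hp.sum_eq_one, fun s t' => ?_⟩
  change p s t' = ∑ t : ℤˣ, signLaw 0 (s * t) * p t t'
  rw [sum_units_int]
  rcases Int.units_eq_one_or s with rfl | rfl <;> simp [signLaw]

theorem degraded_chan (hη0 : 0 ≤ η) (hη1 : η ≤ 1) (hδ0 : 0 ≤ δ) (hδ1 : δ ≤ 1) :
    ∀ k, Degraded (chan d η 0 k) (chan d η δ k)
  | 0 => degraded_chan_zero (isChannel_chan hη0 hη1 hδ0 hδ1 0)
  | k + 1 => ((degraded_chan hη0 hη1 hδ0 hδ1 k).edge η).tensor d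

theorem degraded_chan_succ (hη0 : 0 ≤ η) (hη1 : η ≤ 1) :
    ∀ k, Degraded (chan d η 0 k) (chan d η 0 (k + 1))
  | 0 => degraded_chan_zero (isChannel_chan hη0 hη1 le_rfl zero_le_one 1)
  | k + 1 => ((degraded_chan_succ hη0 hη1 k).edge η).tensor d

theorem bhatt_chan_succ (hη0 : 0 ≤ η) (hη1 : η ≤ 1) (hδ0 : 0 ≤ δ) (hδ1 : δ ≤ 1) (k : ℕ) :
    bhatt (chan d η δ (k + 1)) = bhatt (edge η (chan d η δ k)) ^ d :=
  bhatt_tensor ((isChannel_chan hη0 hη1 hδ0 hδ1 k).edge hη0 hη1) d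

/-- Supplies the positive seed for the doubling in `eventually_bhatt_chan_le`; strictness of `δ <
1/2` is essential here. -/
theorem bhatt_chan_zero_lt_one (hδ1 : δ < 1 / 2) : bhatt (chan d η δ 0) < 1 := by
  have : bhatt (chan d η δ 0) = 2 * √(δ * (1 - δ)) := by
    change ∑ t : ℤˣ, √(signLaw δ (1 * t) * signLaw δ (-1 * t)) = _
    rw [sum_units_int]
    simp [signLaw, mul_comm (1 - δ) δ]; ring
  rw [this]
  have : √(δ * (1 - δ)) < 1 / 2 := by
    rw [Real.sqrt_lt' (by norm_num)]; nlinarith [mul_pos (sub_pos.2 hδ1) (sub_pos.2 hδ1)]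
  linarith

/-- With `u = c b`, `1 - e^(-u) ≥ u/(1+u)`, which is at least `u/2 ≥ 2b` if `u ≤ 1` and at least
`1/2` otherwise. -/
theorem min_two_mul_le_one_sub_exp {c b : ℝ} (hc : 4 ≤ c) (hb : 0 ≤ b) :
    min (2 * b) (1 / 2) ≤ 1 - Real.exp (-(c * b)) := by
  have hcb : 0 ≤ c * b := by positivity
  have h1 : Real.exp (-(c * b)) ≤ 1 / (1 + c * b) := by
    rw [Real.exp_neg, ← one_div]
    exact one_div_le_one_div_of_le (by positivity) (by linarith [Real.add_one_le_exp (c * b)])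
  have h2 : 1 / (1 + c * b) = 1 - c * b / (1 + c * b) := by field_simp; ring
  have h3 : min (2 * b) (1 / 2) ≤ c * b / (1 + c * b) := by
    rcases le_total (c * b) 1 with h | h
    · refine (min_le_left _ _).trans ((le_div_iff₀ (by positivity)).2 ?_)
      nlinarith
    · refine (min_le_right _ _).trans ((le_div_iff₀ (by positivity)).2 ?_)
      linarith
  linarith

theorem bhatt_chan_succ_le (hη0 : 0 ≤ η) (hη1 : η ≤ 1) (hδ0 : 0 ≤ δ) (hδ1 : δ ≤ 1)
    (hd : 8 ≤ (1 - 2 * η) ^ 2 * d) (k : ℕ) :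
    min (2 * (1 - bhatt (chan d η δ k))) (1 / 2) ≤ 1 - bhatt (chan d η δ (k + 1)) := by
  have hp := isChannel_chan (d := d) hη0 hη1 hδ0 hδ1 k
  -- This `c` comes from `(1 - θ²b/2)^d ≤ exp(-(θ²d/2) b)`; `8 ≤ θ²d` makes it at least `4`.
  refine (min_two_mul_le_one_sub_exp (c := (1 - 2 * η) ^ 2 * d / 2) (by linarith)
    (sub_nonneg.2 (bhatt_le_one hp))).trans ?_
  rw [bhatt_chan_succ hη0 hη1 hδ0 hδ1]
  have h1 : bhatt (edge η (chan d η δ k)) ≤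
      Real.exp (-((1 - 2 * η) ^ 2 / 2 * (1 - bhatt (chan d η δ k)))) := by
    refine (bhatt_edge_le hp hη0 hη1).trans ?_
    linarith [Real.add_one_le_exp (-((1 - 2 * η) ^ 2 / 2 * (1 - bhatt (chan d η δ k))))]
  have h2 := pow_le_pow_left₀ (bhatt_nonneg _) h1 d
  rw [← Real.exp_nat_mul] at h2
  have h3 : (d : ℝ) * -((1 - 2 * η) ^ 2 / 2 * (1 - bhatt (chan d η δ k))) =
    -((1 - 2 * η) ^ 2 * d / 2 * (1 - bhatt (chan d η δ k))) := by ring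
  rw [h3] at h2
  linarith

theorem eventually_bhatt_chan_le (hη0 : 0 ≤ η) (hη1 : η ≤ 1) (hδ0 : 0 ≤ δ) (hδ1 : δ < 1 / 2)
    (hd : 8 ≤ (1 - 2 * η) ^ 2 * d) : ∀ᶠ k in atTop, bhatt (chan d η δ k) ≤ 1 / 2 := by
  set β := 1 - bhatt (chan d η δ 0) with hβ
  have hβ0 : 0 < β := by have := bhatt_chan_zero_lt_one (d := d) (η := η) hδ1; linarith
  have key : ∀ k : ℕ, min (2 ^ k * β) (1 / 2) ≤ 1 - bhatt (chan d η δ k) := by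
    intro k
    induction k with
    | zero => simp [hβ]
    | succ k ih =>
      refine le_trans ?_ (bhatt_chan_succ_le hη0 hη1 hδ0 (by linarith) hd k)
      refine le_min ?_ (min_le_right _ _)
      rcases min_le_iff.1 ih with h | h
      · exact (min_le_left _ _).trans (by rw [pow_succ]; linarith)
      · exact (min_le_right _ _).trans (by linarith)
  have hlim : Tendsto (fun k : ℕ => (2 : ℝ) ^ k * β) atTop atTop :=
    (tendsto_pow_atTop_atTop_of_one_lt one_lt_two).atTop_mul_const hβ0
  filter_upwards [hlim.eventually_ge_atTop (1 / 2)] with k hk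
  have := key k
  rw [min_eq_right hk] at this
  linarith

theorem pow_sub_pow_le {a b : ℝ} (ha : 0 ≤ a) (hab : a ≤ b) (d : ℕ) :
    b ^ d - a ^ d ≤ d * b ^ (d - 1) * (b - a) := by
  have := (Commute.all b a).geom_sum₂_mul d
  rw [← this]
  refine mul_le_mul_of_nonneg_right ?_ (by linarith)
  calc _ ≤ ∑ i ∈ Finset.range d, b ^ (d - 1) := Finset.sum_le_sum fun i hi => by
        have hb : 0 ≤ b := ha.trans hab
        have hi' : i ≤ d - 1 := by have := Finset.mem_range.1 hi; omega
        calc b ^ i * a ^ (d - 1 - i) ≤ b ^ i * b ^ (d - 1 - i) := by gcongr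
          _ = b ^ (d - 1) := by rw [← pow_add]; congr 1; omega
    _ = _ := by simp

theorem contraction_factor_le {θ2 : ℝ} (h1 : θ2 ≤ 1) (hd : 256 ≤ θ2 * d) {B : ℝ}
    (hB0 : 0 ≤ B) (hB : B ≤ 1 - θ2 / 4) : θ2 * d * B ^ (d - 1) ≤ 1 / 2 := by
  have hd2 : (256 : ℝ) ≤ d := by nlinarith [(Nat.cast_nonneg d : (0 : ℝ) ≤ d)]
  have hd1 : 1 ≤ d := by
    have : (1 : ℝ) ≤ d := by linarith
    exact_mod_cast this
  set t := θ2 * d with ht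
  -- The bound `d - 1 ≥ d/2` turns `exp(-θ2 (d-1)/4)` into `exp(-t/8)`.
  have h2 : B ^ (d - 1) ≤ Real.exp (-(t / 8)) := by
    have h3 : B ≤ Real.exp (-(θ2 / 4)) := by linarith [Real.add_one_le_exp (-(θ2 / 4))]
    refine (pow_le_pow_left₀ hB0 h3 _).trans ?_
    rw [← Real.exp_nat_mul, Nat.cast_sub hd1, Real.exp_le_exp, ht, Nat.cast_one]
    nlinarith
  have h4 : (t / 8) ^ 2 / 2 ≤ Real.exp (t / 8) := by
    have := Real.quadratic_le_exp_of_nonneg (x := t / 8) (by linarith)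
    linarith
  have h5 : Real.exp (-(t / 8)) ≤ 1 / ((t / 8) ^ 2 / 2) := by
    rw [Real.exp_neg, ← one_div]
    exact one_div_le_one_div_of_le (by positivity) h4
  -- The resulting bound `128/t` is where the threshold `256` comes from.
  calc t * B ^ (d - 1) ≤ t * (1 / ((t / 8) ^ 2 / 2)) := by
        have := h2.trans h5
        gcongr
    _ = 128 / t := by field_simp; norm_num
    _ ≤ 1 / 2 := by rw [div_le_iff₀ (by linarith)]; linarith

theorem bhatt_chan_sub_succ_le (hη0 : 0 ≤ η) (hη1 : η ≤ 1) (hδ0 : 0 ≤ δ) (hδ1 : δ ≤ 1)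
    (hd : 256 ≤ (1 - 2 * η) ^ 2 * d) {k : ℕ} (hk : bhatt (chan d η δ k) ≤ 1 / 2) :
    bhatt (chan d η δ (k + 1)) - bhatt (chan d η 0 (k + 1)) ≤
      1 / 2 * (bhatt (chan d η δ k) - bhatt (chan d η 0 k)) := by
  have hp := isChannel_chan (d := d) hη0 hη1 le_rfl zero_le_one k
  have hq := isChannel_chan (d := d) hη0 hη1 hδ0 hδ1 k
  have hpq := degraded_chan (d := d) hη0 hη1 hδ0 hδ1 k
  rw [bhatt_chan_succ hη0 hη1 hδ0 hδ1, bhatt_chan_succ hη0 hη1 le_rfl zero_le_one]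
  have hsub := hpq.bhatt_le hp hq
  have hle := (hpq.edge η).bhatt_le (hp.edge hη0 hη1) (hq.edge hη0 hη1)
  have hstep := hpq.bhatt_edge_sub_le hp hq hη0 hη1
  have hB := bhatt_edge_le hq hη0 hη1
  have hB0 := bhatt_nonneg (edge η (chan d η δ k))
  -- A coefficient of at most `1/2` before the edge gives `1 - θ²/4` after it.
  have hfac := contraction_factor_le (θ2 := (1 - 2 * η) ^ 2) (by nlinarith) hd hB0
    (hB.trans (by nlinarith [sq_nonneg (1 - 2 * η)]))
  calc _ ≤ _ := pow_sub_pow_le (bhatt_nonneg _) hle d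
    _ ≤ d * bhatt (edge η (chan d η δ k)) ^ (d - 1) *
        ((1 - 2 * η) ^ 2 * (bhatt (chan d η δ k) - bhatt (chan d η 0 k))) := by gcongr
    _ = ((1 - 2 * η) ^ 2 * d * bhatt (edge η (chan d η δ k)) ^ (d - 1)) *
        (bhatt (chan d η δ k) - bhatt (chan d η 0 k)) := by ring
    _ ≤ _ := mul_le_mul_of_nonneg_right hfac (sub_nonneg.2 hsub)

theorem tendsto_bhatt_chan_sub (hη0 : 0 ≤ η) (hη1 : η ≤ 1) (hδ0 : 0 ≤ δ) (hδ1 : δ < 1 / 2)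
    (hd : 256 ≤ (1 - 2 * η) ^ 2 * d) :
    Tendsto (fun k => bhatt (chan d η δ k) - bhatt (chan d η 0 k)) atTop (𝓝 0) := by
  have hδ1' : δ ≤ 1 := by linarith
  obtain ⟨K, hK⟩ := eventually_atTop.1
    (eventually_bhatt_chan_le (d := d) hη0 hη1 hδ0 hδ1 (by linarith))
  set a := fun k => bhatt (chan d η δ k) - bhatt (chan d η 0 k) with ha
  have hbound : ∀ n, a (n + K) ≤ (1 / 2) ^ n * a K := by
    intro n
    induction n with
    | zero => simp
    | succ n ih =>
      have := bhatt_chan_sub_succ_le (d := d) hη0 hη1 hδ0 hδ1' hd (hK (n + K) (by omega))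
      rw [show n + 1 + K = n + K + 1 by ring, pow_succ]
      change a (n + K + 1) ≤ 1 / 2 * a (n + K) at this
      linarith
  refine (tendsto_add_atTop_iff_nat K).1 (squeeze_zero (fun n => ?_) hbound ?_)
  · exact sub_nonneg.2 ((degraded_chan hη0 hη1 hδ0 hδ1' _).bhatt_le
      (isChannel_chan hη0 hη1 le_rfl zero_le_one _) (isChannel_chan hη0 hη1 hδ0 hδ1' _))
  · simpa using (tendsto_pow_atTop_nhds_zero_of_lt_one (r := (1 / 2 : ℝ)) (by norm_num)
      (by norm_num)).mul_const (a K)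

/-- Each exact level is a degradation of the previous one, so `tv` decreases and is bounded below by
`0`. -/
theorem exists_tendsto_tv_chan (d : ℕ) (hη0 : 0 ≤ η) (hη1 : η ≤ 1) :
    ∃ l, Tendsto (fun k => tv (chan d η 0 k)) atTop (𝓝 l) := by
  refine ⟨_, tendsto_atTop_ciInf (antitone_nat_of_succ_le fun k => ?_) ⟨0, ?_⟩⟩
  · exact (degraded_chan_succ hη0 hη1 k).tv_le (isChannel_chan hη0 hη1 le_rfl zero_le_one _)
      (isChannel_chan hη0 hη1 le_rfl zero_le_one _)
  · rintro _ ⟨k, rfl⟩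
    exact Finset.sum_nonneg fun _ _ => by positivity

theorem tendsto_tv_chan_sub (hη0 : 0 ≤ η) (hη1 : η ≤ 1) (hδ0 : 0 ≤ δ) (hδ1 : δ < 1 / 2)
    (hd : 256 ≤ (1 - 2 * η) ^ 2 * d) :
    Tendsto (fun k => tv (chan d η 0 k) - tv (chan d η δ k)) atTop (𝓝 0) := by
  have hδ1' : δ ≤ 1 := by linarith
  have hp := isChannel_chan (d := d) hη0 hη1 le_rfl zero_le_one
  have hq := isChannel_chan (d := d) hη0 hη1 hδ0 hδ1'
  have hpq := degraded_chan (d := d) hη0 hη1 hδ0 hδ1'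
  rw [Metric.tendsto_atTop]
  intro ε hε
  -- A gap below `(ε/2)²` makes both error terms of `Degraded.tv_le_add`, used with `ε/2`, at most
  -- `ε/2`.
  obtain ⟨K, hK⟩ := eventually_atTop.1 ((tendsto_bhatt_chan_sub (d := d) hη0 hη1 hδ0 hδ1
    hd).eventually_lt_const (show 0 < ε / 2 * (ε / 2) by positivity))
  refine ⟨K, fun k hk => ?_⟩
  have h1 := (hpq k).tv_le_add (hp k) (hq k) (half_pos hε)
  have h2 : 1 / (ε / 2) * (bhatt (chan d η δ k) - bhatt (chan d η 0 k)) < ε / 2 := by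
    rw [one_div, inv_mul_lt_iff₀ (by positivity)]; exact hK k hk
  have h3 := (hpq k).tv_le (hp k) (hq k)
  rw [Real.dist_eq, sub_zero, abs_of_nonneg (by linarith)]
  linarith

end Dynamics

/-! ### Elementary conditional probabilities given a finite observation. -/

section Elementary

variable {Ω β : Type*} [MeasurableSpace Ω] {P : Measure Ω}

/-- Only the partition induced by the observation matters; this lets `readLevel` replace the
restriction to `level [] k`. -/
theorem condProb_congr {β' : Type*} {Z : Ω → β} {Z' : Ω → β'}
    (h : ∀ ω ω', Z ω' = Z ω ↔ Z' ω' = Z' ω) (A : Set Ω) : condProb P A Z = condProb P A Z' := by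
  funext ω
  simp only [condProb, h]

variable [MeasurableSpace β] [DiscreteMeasurableSpace β]

theorem condProb_eq {Z : Ω → β} (hZ : Measurable Z) (A : Set Ω) (ω : Ω) :
    condProb P A Z ω =
      (fun b => (P.real {ω | Z ω = b})⁻¹ * P.real (A ∩ {ω | Z ω = b})) (Z ω) := by
  have h : MeasurableSet {ω' | Z ω' = Z ω} := hZ (measurableSet_singleton (Z ω))
  simp only [condProb, measureReal_def, ProbabilityTheory.cond_apply h, ENNReal.toReal_mul,
    ENNReal.toReal_inv, Set.inter_comm A]

variable [Fintype β] [IsProbabilityMeasure P]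

theorem integral_comp_fintype {Z : Ω → β} (hZ : Measurable Z) (f : β → ℝ) :
    ∫ ω, f (Z ω) ∂P = ∑ b, P.real {ω | Z ω = b} * f b := by
  have : IsProbabilityMeasure (P.map Z) := Measure.isProbabilityMeasure_map hZ.aemeasurable
  rw [← integral_map hZ.aemeasurable (by fun_prop), integral_fintype .of_finite]
  refine Finset.sum_congr rfl fun b _ => ?_
  rw [map_measureReal_apply hZ (measurableSet_singleton b)]
  rfl

/-- The expected absolute difference of two posteriors as a sum over the observations. -/
theorem integral_abs_condProb_sub {Z : Ω → β} (hZ : Measurable Z) (A A' : Set Ω) :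
    ∫ ω, |condProb P A Z ω - condProb P A' Z ω| ∂P =
      ∑ b, |P.real (A ∩ {ω | Z ω = b}) - P.real (A' ∩ {ω | Z ω = b})| := by
  simp_rw [condProb_eq hZ]
  rw [integral_comp_fintype hZ (fun b => |(P.real {ω | Z ω = b})⁻¹ * P.real (A ∩ {ω | Z ω = b}) -
    (P.real {ω | Z ω = b})⁻¹ * P.real (A' ∩ {ω | Z ω = b})|)]
  refine Finset.sum_congr rfl fun b _ => ?_
  have h1 : P.real (A ∩ {ω | Z ω = b}) ≤ P.real {ω | Z ω = b} :=
    measureReal_mono Set.inter_subset_right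
  have h2 : P.real (A' ∩ {ω | Z ω = b}) ≤ P.real {ω | Z ω = b} :=
    measureReal_mono Set.inter_subset_right
  have h0 : 0 ≤ P.real {ω | Z ω = b} := measureReal_nonneg
  rcases h0.eq_or_lt with h | h
  -- Values of probability zero contribute nothing to either side.
  · rw [← h] at h1 h2 ⊢
    rw [h1.antisymm measureReal_nonneg, h2.antisymm measureReal_nonneg]; simp
  · rw [← mul_sub, abs_mul, abs_of_pos (inv_pos.2 h), mul_inv_cancel_left₀ h.ne']

theorem integral_abs_condProb_sub_half {Z : Ω → β} (hZ : Measurable Z) {A : Set Ω}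
    (hA : MeasurableSet A) :
    ∫ ω, |condProb P A Z ω - 1 / 2| ∂P =
      1 / 2 * ∫ ω, |condProb P A Z ω - condProb P Aᶜ Z ω| ∂P := by
  rw [integral_abs_condProb_sub hZ]
  simp_rw [condProb_eq hZ]
  rw [integral_comp_fintype hZ (fun b => |(P.real {ω | Z ω = b})⁻¹ * P.real (A ∩ {ω | Z ω = b}) -
    1 / 2|), Finset.mul_sum]
  refine Finset.sum_congr rfl fun b _ => ?_
  have h1 : P.real (A ∩ {ω | Z ω = b}) + P.real (Aᶜ ∩ {ω | Z ω = b}) = P.real {ω | Z ω = b} := by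
    rw [Set.inter_comm, Set.inter_comm Aᶜ, ← Set.sdiff_eq]
    exact measureReal_inter_add_sdiff hA
  have h2 : 0 ≤ P.real (A ∩ {ω | Z ω = b}) := measureReal_nonneg
  have h3 : 0 ≤ P.real (Aᶜ ∩ {ω | Z ω = b}) := measureReal_nonneg
  rw [← h1]
  rcases (add_nonneg h2 h3).eq_or_lt with h | h
  · have h2' : P.real (A ∩ {ω | Z ω = b}) = 0 := by linarith
    have h3' : P.real (Aᶜ ∩ {ω | Z ω = b}) = 0 := by linarith
    simp [h2', h3']
  · rw [← abs_of_pos h, ← abs_mul, abs_of_pos h, mul_sub, mul_inv_cancel_left₀ h.ne',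
      ← abs_of_pos (show (0 : ℝ) < 1 / 2 by norm_num), ← abs_mul,
      abs_of_pos (show (0 : ℝ) < 1 / 2 by norm_num)]
    congr 1; ring

end Elementary

/-! ### The tree process realizes the channels `chan`. -/

/-- Independent families indexed by a disjoint union form a product of two independent families. -/
theorem infinitePi_map_sum {ι κ α : Type*} [MeasurableSpace α] (P : ι ⊕ κ → Measure α)
    [∀ i, IsProbabilityMeasure (P i)] :
    (Measure.infinitePi P).map (fun x => (fun i => x (.inl i), fun j => x (.inr j))) =
      (Measure.infinitePi fun i => P (.inl i)).prod (Measure.infinitePi fun j => P (.inr j)) := by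
  have hm : Measurable fun y : (ι → α) × (κ → α) => (Sum.elim y.1 y.2 : ι ⊕ κ → α) := by
    refine measurable_pi_iff.2 ?_
    rintro (i | j)
    · exact (measurable_pi_apply i).comp measurable_fst
    · exact (measurable_pi_apply j).comp measurable_snd
  have h : ((Measure.infinitePi fun i => P (.inl i)).prod
      (Measure.infinitePi fun j => P (.inr j))).map (fun y => Sum.elim y.1 y.2) =
        Measure.infinitePi P := by
    refine Measure.eq_infinitePi _ fun s t ht => ?_
    have hpre : (fun y : (ι → α) × (κ → α) => (Sum.elim y.1 y.2 : ι ⊕ κ → α)) ⁻¹'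
        (Set.pi s t) = (Set.pi s.toLeft fun i => t (.inl i)) ×ˢ
          (Set.pi s.toRight fun j => t (.inr j)) := by
      ext y
      simp [Set.mem_pi]
    rw [Measure.map_apply hm (.pi s.countable_toSet fun i _ => ht i), hpre, Measure.prod_prod,
      Measure.infinitePi_pi _ fun i _ => ht _, Measure.infinitePi_pi _ fun i _ => ht _,
      Finset.prod_sum_eq_prod_toLeft_mul_prod_toRight]
  rw [← h, Measure.map_map (by fun_prop) hm]
  exact Measure.map_id

instance instDiscreteMeasurableSpaceUnitsInt : DiscreteMeasurableSpace ℤˣ where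
  forall_measurableSet s :=
    ⟨Units.val '' s, trivial, Set.preimage_image_eq _ Units.val_injective⟩

instance instMeasurableSpaceObs (d k : ℕ) : MeasurableSpace (Obs d k) := ⊤

instance instDiscreteMeasurableSpaceObs (d k : ℕ) : DiscreteMeasurableSpace (Obs d k) :=
  ⟨fun _ => trivial⟩

/-- The labels of the `k`-th level. -/
def readLevel {d : ℕ} : ∀ k, Labeling d → Obs d k
  | 0, f => f []
  | k + 1, f => fun i => readLevel k fun u => f (i :: u)

theorem readLevel_succ_eq_iff {d k : ℕ} (f : Labeling d) (t : Fin d → Obs d k) :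
    readLevel (k + 1) f = t ↔ ∀ i, readLevel k (fun u => f (i :: u)) = t i :=
  funext_iff

theorem readLevel_eq_iff {d : ℕ} (k : ℕ) (f g : Labeling d) :
    readLevel k f = readLevel k g ↔ ∀ v : Vertex d, v.length = k → f v = g v := by
  induction k generalizing f g with
  | zero =>
    simp only [List.length_eq_zero_iff, forall_eq]
    exact Iff.rfl
  | succ k ih =>
    refine (readLevel_succ_eq_iff f _).trans ((forall_congr' fun i => ih _ _).trans
      ⟨fun h v hv => ?_, fun h i v hv => h _ (by simp [hv])⟩)
    obtain ⟨i, u, rfl⟩ := List.exists_cons_of_length_eq_add_one hv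
    exact h i u (by simpa using hv)

theorem measurable_readLevel {d : ℕ} (k : ℕ) : Measurable (readLevel (d := d) k) := by
  refine measurable_to_countable' fun t => ?_
  induction k with
  | zero => exact measurable_pi_apply (X := fun _ : Vertex d => ℤˣ) [] (measurableSet_singleton _)
  | succ k ih =>
    have : readLevel (k + 1) ⁻¹' {t} =
        ⋂ i, (fun f : Labeling d => fun u => f (i :: u)) ⁻¹' (readLevel k ⁻¹' {t i}) := by
      ext f
      simpa using readLevel_succ_eq_iff f t
    rw [this]
    exact .iInter fun i => (ih (t i)).preimage (by fun_prop)

theorem sigma_cons {d : ℕ} (i : Fin d) (u : Vertex d) (ε : Labeling d) :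
    sigma (i :: u) ε = ε [] * sigma u fun w => ε (i :: w) := by
  simp [sigma, Function.comp_def]

@[fun_prop]
theorem measurable_sigma {d : ℕ} (u : Vertex d) : Measurable (sigma u) := by
  induction u using List.reverseRecOn with
  | nil => simp only [funext sigma_root]; fun_prop
  | append_singleton u i ih => simp only [funext (sigma_child u i)]; fun_prop

/-- An edge sign and a noise sign for each vertex. -/
abbrev Signs (d : ℕ) : Type := Vertex d ⊕ Vertex d → ℤˣ

/-- The flip probability of each sign. -/
def rate {d : ℕ} (r η δ : unitInterval) : Vertex d ⊕ Vertex d → unitInterval :=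
  Sum.elim (fun u => if u = [] then r else η) fun _ => δ

/-- Independent edge signs and noise signs, the root being flipped with probability `r`. -/
def signMeasure (d : ℕ) (r η δ : unitInterval) : Measure (Signs d) :=
  Measure.infinitePi fun x => ProbabilityTheory.bernoulliMeasure (-1 : ℤˣ) 1 (rate r η δ x)

instance (d : ℕ) (r η δ : unitInterval) : IsProbabilityMeasure (signMeasure d r η δ) := by
  unfold signMeasure; infer_instance

instance (d : ℕ) (η : unitInterval) : IsProbabilityMeasure (broadcastMeasure d η) := by
  unfold broadcastMeasure; infer_instance

instance (d : ℕ) (η δ : unitInterval) : IsProbabilityMeasure (noisyMeasure d η δ) := by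
  unfold noisyMeasure; infer_instance

theorem noisyMeasure_eq_map (d : ℕ) (η δ : unitInterval) :
    noisyMeasure d η δ = (signMeasure d half η δ).map
      fun x => (fun u => x (.inl u), fun u => x (.inr u)) :=
  (infinitePi_map_sum fun x : Vertex d ⊕ Vertex d =>
    ProbabilityTheory.bernoulliMeasure (-1 : ℤˣ) 1 (rate half η δ x)).symm

theorem bernoulliMeasure_real_singleton (r : unitInterval) (e : ℤˣ) :
    (ProbabilityTheory.bernoulliMeasure (-1 : ℤˣ) 1 r).real {e} = signLaw r e := by
  rw [ProbabilityTheory.bernoulliMeasure_real_apply r (measurableSet_singleton e)]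
  rcases Int.units_eq_one_or e with rfl | rfl
  · have : (-1 : ℤˣ) ≠ 1 := by decide
    simp [signLaw, this]
  · have : (1 : ℤˣ) ≠ -1 := by decide
    simp [signLaw, this]

/-- The signs of the subtree below the `i`-th child of the root. -/
def childSigns {d : ℕ} (i : Fin d) (x : Signs d) : Signs d :=
  Sum.elim (fun u => x (.inl (i :: u))) fun u => x (.inr (i :: u))

/-- The sign of the root is independent of the subtrees below its children, which are independent
of each other. -/
theorem signMeasure_root_children {d : ℕ} (r η δ : unitInterval) (e : ℤˣ)
    {B : Fin d → Set (Signs d)} (hB : ∀ i, MeasurableSet (B i)) :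
    (signMeasure d r η δ).real {x | x (.inl []) = e ∧ ∀ i, childSigns i x ∈ B i} =
      signLaw r e * ∏ i, (signMeasure d η η δ).real (B i) := by
  -- The coordinates in the event: the root's edge sign and every sign below each child. The map
  -- misses only the root's noise sign, so injectivity suffices to pass to a marginal.
  let g : Unit ⊕ (Fin d × (Vertex d ⊕ Vertex d)) → Vertex d ⊕ Vertex d :=
    Sum.elim (fun _ => .inl []) fun y => Sum.map (y.1 :: ·) (y.1 :: ·) y.2
  have hg : Function.Injective g := by
    rintro (_ | ⟨i, u | u⟩) (_ | ⟨j, v | v⟩) h <;> simp_all [g]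
  -- A child's own edge sign has rate `η`, so its subtree has root rate `η`; hence the free
  -- parameter `r`.
  have hrate : ∀ y, rate r η δ (g (.inr y)) = rate η η δ y.2 := by
    rintro ⟨i, u | u⟩ <;> simp [g, rate]
  have h1 := Measure.map_infinitePi_infinitePi_of_inj
    (P := fun x => ProbabilityTheory.bernoulliMeasure (-1 : ℤˣ) 1 (rate (d := d) r η δ x)) hg
  have h2 := infinitePi_map_sum
    fun y => ProbabilityTheory.bernoulliMeasure (-1 : ℤˣ) 1 (rate (d := d) r η δ (g y))
  simp only [hrate] at h2
  have h3 := Measure.infinitePi_map_curry fun (_ : Fin d) x =>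
    ProbabilityTheory.bernoulliMeasure (-1 : ℤˣ) 1 (rate (d := d) η η δ x)
  have hA : MeasurableSet {y : Unit → ℤˣ | y () = e} :=
    measurable_pi_apply (X := fun _ : Unit => ℤˣ) () (measurableSet_singleton e)
  have hC : MeasurableSet (Set.univ.pi B) := .univ_pi hB
  have hC' := hC.preimage (MeasurableEquiv.curry (Fin d) (Vertex d ⊕ Vertex d) ℤˣ).measurable
  have hset : {x : Signs d | x (.inl []) = e ∧ ∀ i, childSigns i x ∈ B i} =
      (fun x y => x (g y)) ⁻¹' ((fun y => (fun i => y (.inl i), fun j => y (.inr j))) ⁻¹'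
        ({y : Unit → ℤˣ | y () = e} ×ˢ
          (MeasurableEquiv.curry (Fin d) (Vertex d ⊕ Vertex d) ℤˣ ⁻¹' Set.univ.pi B))) := by
    ext x
    have : ∀ i, childSigns i x = fun z => x (g (.inr (i, z))) := by
      intro i; ext (u | u) <;> rfl
    simp only [this, Set.mem_preimage, Set.mem_prod, Set.mem_univ_pi, Set.mem_ofPred_eq]
    rfl
  have key : (signMeasure d r η δ) {x | x (.inl []) = e ∧ ∀ i, childSigns i x ∈ B i} =
      (ProbabilityTheory.bernoulliMeasure (-1 : ℤˣ) 1 r) {e} *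
        ∏ i, (signMeasure d η η δ) (B i) := by
    rw [hset, signMeasure, ← Measure.map_apply (by fun_prop)
      ((hA.prod hC').preimage (by fun_prop)), h1, ← Measure.map_apply (by fun_prop) (hA.prod hC'),
      h2, Measure.prod_prod, ← Measure.map_apply (MeasurableEquiv.measurable _) hC, h3,
      Measure.infinitePi_pi_univ _ hB, tprod_fintype]
    congr 1
    rw [← (measurePreserving_eval_infinitePi (fun _ : Unit =>
      ProbabilityTheory.bernoulliMeasure (-1 : ℤˣ) 1 r) ()).measure_preimage
      (measurableSet_singleton e).nullMeasurableSet]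
    simp [g, rate]
    rfl
  rw [Measure.real, key, ENNReal.toReal_mul, ENNReal.toReal_prod]
  exact congrArg₂ _ (bernoulliMeasure_real_singleton r e) rfl

theorem measurableSet_readLevel_tau {d k : ℕ} (s : ℤˣ) (t : Obs d k) : MeasurableSet {x : Signs d |
    readLevel k (fun u => s * (sigma u (fun v => x (.inl v)) * x (.inr u))) = t} := by
  refine ((measurable_readLevel k) (measurableSet_singleton t)).preimage
    (measurable_pi_iff.2 fun u => ?_)
  exact (((measurable_sigma u).comp (by fun_prop)).mul (by fun_prop)).const_mul s

/-- The joint law of the root sign and the noisy labels of a level. -/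
theorem signMeasure_readLevel {d : ℕ} (r η δ : unitInterval) (k : ℕ) (s e : ℤˣ) (t : Obs d k) :
    (signMeasure d r η δ).real {x | x (.inl []) = e ∧
      readLevel k (fun u => s * (sigma u (fun v => x (.inl v)) * x (.inr u))) = t} =
        signLaw r e * chan d η δ k (s * e) t := by
  induction k generalizing r s e with
  | zero =>
    change ℤˣ at t
    have hset : {x : Signs d | x (.inl []) = e ∧
        readLevel 0 (fun u => s * (sigma u (fun v => x (.inl v)) * x (.inr u))) = t} =
          Set.pi (({.inl [], .inr []} : Finset (Vertex d ⊕ Vertex d)) : Set (Vertex d ⊕ Vertex d))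
            (Sum.elim (fun _ => {e}) fun _ => {s * e * t}) := by
      ext x
      simp only [readLevel, sigma_root, Set.mem_ofPred_eq, Finset.coe_insert,
        Finset.coe_singleton, Set.insert_pi, Set.singleton_pi, Set.mem_inter_iff,
        Set.mem_preimage, Function.eval, Sum.elim_inl, Sum.elim_inr, Set.mem_singleton_iff]
      refine and_congr_right fun h => ?_
      change s * (x (.inl []) * x (.inr [])) = t ↔ _
      rw [h, ← mul_assoc, ← eq_inv_mul_iff_mul_eq, Int.units_inv_eq_self]
    rw [hset, signMeasure, Measure.real, Measure.infinitePi_pi, Finset.prod_pair (by simp),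
      ENNReal.toReal_mul]
    · exact congrArg₂ _ (bernoulliMeasure_real_singleton r e)
        (bernoulliMeasure_real_singleton δ (s * e * t))
    · exact fun _ _ => .of_discrete
  | succ k ih =>
    change Fin d → Obs d k at t
    have hset : {x : Signs d | x (.inl []) = e ∧
        readLevel (k + 1) (fun u => s * (sigma u (fun v => x (.inl v)) * x (.inr u))) = t} =
          -- The factor `s` accumulates the signs of the ancestors: each subtree sees `s * e`.
          {x | x (.inl []) = e ∧ ∀ i, childSigns i x ∈ {x : Signs d |
            readLevel k (fun u => s * e * (sigma u (fun v => x (.inl v)) * x (.inr u))) =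
              t i}} := by
      ext x
      refine and_congr_right fun h => (readLevel_succ_eq_iff _ _).trans (forall_congr' fun i => ?_)
      simp only [sigma_cons, h, childSigns, Set.mem_ofPred_eq, Sum.elim_inl, Sum.elim_inr,
        mul_assoc]
    refine (congrArg _ hset).trans ((signMeasure_root_children r η δ e fun i =>
      measurableSet_readLevel_tau (s * e) (t i)).trans (congrArg _ ?_))
    refine Finset.prod_congr rfl fun i _ => ?_
    have hm : MeasurableSet {x : Signs d | x (.inl []) = 1} :=
      measurable_pi_apply (X := fun _ : Vertex d ⊕ Vertex d => ℤˣ) _ (measurableSet_singleton 1)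
    -- Splitting on the child's own sign matches the two terms of `edge`.
    rw [← measureReal_inter_add_sdiff hm, edge, sum_units_int, ← ih, ← ih]
    congr 2
    · ext x; simp [and_comm]
    · ext x
      have : x (.inl []) ≠ 1 ↔ x (.inl []) = -1 := by
        rcases Int.units_eq_one_or (x (.inl [])) with h | h <;> rw [h] <;> decide
      simp [and_comm, this]

theorem measurable_tau {d : ℕ} : Measurable fun (ω : Labeling d × Labeling d) u => tau u ω :=
  measurable_pi_iff.2 fun u => ((measurable_sigma u).comp measurable_fst).mul
    ((measurable_pi_apply u).comp measurable_snd)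

theorem measurableSet_sigma_eq {d : ℕ} (u : Vertex d) (s : ℤˣ) :
    MeasurableSet {ε | sigma u ε = s} :=
  measurable_sigma u (measurableSet_singleton s)

theorem noisyMeasure_readLevel {d : ℕ} (η δ : unitInterval) (k : ℕ) (s : ℤˣ) (t : Obs d k) :
    (noisyMeasure d η δ).real ({ω | sigma [] ω.1 = s} ∩ {ω | readLevel k (fun u => tau u ω) = t}) =
      1 / 2 * chan d η δ k s t := by
  have h := signMeasure_readLevel half η δ k 1 s t
  have hhalf : signLaw half s = 1 / 2 := by
    unfold signLaw half; split_ifs <;> norm_num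
  rw [one_mul, hhalf] at h
  rw [← h, noisyMeasure_eq_map, map_measureReal_apply (by fun_prop)]
  · simp only [one_mul, tau]
    congr 1
    ext x
    simp [sigma_root]
  · exact ((measurableSet_sigma_eq [] s).preimage measurable_fst).inter
      (((measurable_readLevel k) (measurableSet_singleton t)).preimage measurable_tau)

/-- At `δ = 0` all noise signs are almost surely `1`, so the exact process is the noisy one with `δ
= 0`. -/
theorem broadcastMeasure_readLevel {d : ℕ} (η : unitInterval) (k : ℕ) (s : ℤˣ) (t : Obs d k) :
    (broadcastMeasure d η).real
        ({ε | sigma [] ε = s} ∩ {ε | readLevel k (fun u => sigma u ε) = t}) =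
      1 / 2 * chan d η 0 k s t := by
  have h := noisyMeasure_readLevel η 0 k s t
  rw [Set.Icc.coe_zero] at h
  have hae : ∀ᵐ ω ∂(noisyMeasure d η 0), ∀ u, ω.2 u = 1 := by
    refine ae_all_iff.2 fun u => ?_
    have h1 : ∀ᵐ ξ ∂(Measure.infinitePi fun _ : Vertex d =>
        ProbabilityTheory.bernoulliMeasure (-1 : ℤˣ) 1 0), ξ u = 1 := by
      refine (measurePreserving_eval_infinitePi (fun _ : Vertex d =>
        ProbabilityTheory.bernoulliMeasure (-1 : ℤˣ) 1 0) u).quasiMeasurePreserving.ae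
          (p := fun x => x = 1) ?_
      simp [ProbabilityTheory.bernoulliMeasure_zero, ae_dirac_eq]
    exact Measure.quasiMeasurePreserving_snd.ae h1
  have hmeas : MeasurableSet ({ε : Labeling d | sigma [] ε = s} ∩
      {ε | readLevel k (fun u => sigma u ε) = t}) :=
    (measurableSet_sigma_eq [] s).inter
      (((measurable_readLevel k) (measurableSet_singleton t)).preimage
      (measurable_pi_iff.2 measurable_sigma))
  rw [← h, ← (measurePreserving_fst (μ := broadcastMeasure d η)
    (ν := Measure.infinitePi fun _ : Vertex d =>
      ProbabilityTheory.bernoulliMeasure (-1 : ℤˣ) 1 0)).measureReal_preimage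
      hmeas.nullMeasurableSet]
  refine measureReal_congr ?_
  filter_upwards [hae] with ω hω
  have : (fun u => tau u ω) = fun u => sigma u ω.1 := by
    ext u; simp [tau, hω]
  refine propext (show ω ∈ Prod.fst ⁻¹' ({ε : Labeling d | sigma [] ε = s} ∩
    {ε | readLevel k (fun u => sigma u ε) = t}) ↔ ω ∈ {ω : Labeling d × Labeling d |
      sigma [] ω.1 = s} ∩ {ω | readLevel k (fun u => tau u ω) = t} from ?_)
  simp [this]

theorem restrict_level_eq_iff {d : ℕ} (k : ℕ) (f g : Labeling d) :
    ((fun v : level ([] : Vertex d) k => f v.1) = fun v => g v.1) ↔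
      readLevel k f = readLevel k g := by
  rw [readLevel_eq_iff, funext_iff]
  refine ⟨fun h v hv => h ⟨v, v, hv, rfl⟩, ?_⟩
  rintro h ⟨w, v, hv, hw⟩
  exact h w (by simp [hw, hv])

theorem tv_eq {T : Type*} [Fintype T] (p : ℤˣ → T → ℝ) :
    ∑ t, |1 / 2 * p 1 t - 1 / 2 * p (-1) t| = tv p := by
  refine Finset.sum_congr rfl fun t _ => ?_
  rw [← mul_sub, abs_mul, abs_of_pos (by norm_num : (0 : ℝ) < 1 / 2)]; ring

theorem integral_abs_Y (d : ℕ) (η δ : unitInterval) (k : ℕ) :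
    ∫ ω, |Y d η δ [] k ω| ∂(noisyMeasure d η δ) = tv (chan d η δ k) := by
  simp only [Y, noisyPosterior]
  simp_rw [condProb_congr (Z' := fun ω => readLevel k fun u => tau u ω)
    fun ω ω' => restrict_level_eq_iff k (fun u => tau u ω') fun u => tau u ω]
  rw [integral_abs_condProb_sub (Z := fun ω => readLevel k fun u => tau u ω)
    ((measurable_readLevel k).comp measurable_tau)]
  simp_rw [noisyMeasure_readLevel]
  exact tv_eq _

theorem integral_abs_X (d : ℕ) (η : unitInterval) (k : ℕ) :
    ∫ ε, |X d η [] k ε| ∂(broadcastMeasure d η) = tv (chan d η 0 k) := by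
  simp only [X, posterior]
  simp_rw [condProb_congr (Z' := fun ε => readLevel k fun u => sigma u ε)
    fun ε ε' => restrict_level_eq_iff k (fun u => sigma u ε') fun u => sigma u ε]
  rw [integral_abs_condProb_sub (Z := fun ε => readLevel k fun u => sigma u ε)
    ((measurable_readLevel k).comp (measurable_pi_iff.2 measurable_sigma))]
  simp_rw [broadcastMeasure_readLevel]
  exact tv_eq _

theorem compl_sigma_eq_one {Ω : Type*} (f : Ω → ℤˣ) : {ω | f ω = 1}ᶜ = {ω | f ω = -1} := by
  ext ω
  change f ω ≠ 1 ↔ f ω = -1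
  rcases Int.units_eq_one_or (f ω) with h | h <;> rw [h] <;> decide

theorem integral_abs_noisyPosterior_sub_half (d : ℕ) (η δ : unitInterval) (k : ℕ) :
    ∫ ω, |noisyPosterior d η δ [] k 1 ω - 1 / 2| ∂(noisyMeasure d η δ) =
      1 / 2 * ∫ ω, |Y d η δ [] k ω| ∂(noisyMeasure d η δ) := by
  simp only [Y, noisyPosterior]
  simp_rw [condProb_congr (Z' := fun ω => readLevel k fun u => tau u ω)
    fun ω ω' => restrict_level_eq_iff k (fun u => tau u ω') fun u => tau u ω]
  rw [integral_abs_condProb_sub_half (Z := fun ω => readLevel k fun u => tau u ω)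
    ((measurable_readLevel k).comp measurable_tau)
    (A := {ω : Labeling d × Labeling d | sigma [] ω.1 = 1})
    ((measurableSet_sigma_eq [] 1).preimage measurable_fst), ← compl_sigma_eq_one]

theorem integral_abs_posterior_sub_half (d : ℕ) (η : unitInterval) (k : ℕ) :
    ∫ ε, |posterior d η [] k 1 ε - 1 / 2| ∂(broadcastMeasure d η) =
      1 / 2 * ∫ ε, |X d η [] k ε| ∂(broadcastMeasure d η) := by
  simp only [X, posterior]
  simp_rw [condProb_congr (Z' := fun ε => readLevel k fun u => sigma u ε)
    fun ε ε' => restrict_level_eq_iff k (fun u => sigma u ε') fun u => sigma u ε]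
  rw [integral_abs_condProb_sub_half (Z := fun ε => readLevel k fun u => sigma u ε)
    ((measurable_readLevel k).comp
    (measurable_pi_iff.2 measurable_sigma)) (measurableSet_sigma_eq [] 1), ← compl_sigma_eq_one]

end TreeBroadcast

end

/-! ### The main theorem. -/

theorem theorem3p2 :
    ∃ C : ℝ, 0 < C ∧ ∀ (d : ℕ) (η : unitInterval), C < (1 - 2 * (η : ℝ)) ^ 2 * (d : ℝ) →
      (∀ δ : unitInterval, (δ : ℝ) < 1 / 2 →
        ∃ l : ℝ,
          Tendsto (fun k : ℕ => ∫ ε, |TreeBroadcast.X d η [] k ε|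
            ∂(TreeBroadcast.broadcastMeasure d η)) atTop (𝓝 l) ∧
          Tendsto (fun k : ℕ => ∫ ω, |TreeBroadcast.Y d η δ [] k ω|
            ∂(TreeBroadcast.noisyMeasure d η δ)) atTop (𝓝 l)) ∧
      (∃ l : ℝ, Tendsto (fun k : ℕ => ∫ ε, |TreeBroadcast.posterior d η [] k 1 ε - 1 / 2|
          ∂(TreeBroadcast.broadcastMeasure d η)) atTop (𝓝 l)) ∧
      TreeBroadcast.pRobustReg d η = TreeBroadcast.pReg d η := by
  refine ⟨256, by norm_num, fun d η hd => ?_⟩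
  obtain ⟨l, hl⟩ := TreeBroadcast.exists_tendsto_tv_chan d η.2.1 η.2.2
  have hY : ∀ δ : unitInterval, (δ : ℝ) < 1 / 2 →
      Tendsto (fun k => TreeBroadcast.tv (TreeBroadcast.chan d η δ k)) atTop (𝓝 l) := by
    intro δ hδ
    simpa using hl.sub (TreeBroadcast.tendsto_tv_chan_sub η.2.1 η.2.2 δ.2.1 hδ hd.le)
  have hpost : Tendsto (fun k : ℕ => ∫ ε, |TreeBroadcast.posterior d η [] k 1 ε - 1 / 2|
      ∂(TreeBroadcast.broadcastMeasure d η)) atTop (𝓝 (1 / 2 * l)) := by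
    simp_rw [TreeBroadcast.integral_abs_posterior_sub_half, TreeBroadcast.integral_abs_X]
    exact hl.const_mul _
  refine ⟨fun δ hδ => ⟨l, ?_, ?_⟩, ⟨_, hpost⟩, ?_⟩
  · simp_rw [TreeBroadcast.integral_abs_X]; exact hl
  · simp_rw [TreeBroadcast.integral_abs_Y]; exact hY δ hδ
  · rw [TreeBroadcast.pRobustReg, TreeBroadcast.pReg, hpost.limUnder_eq]
    congr 1
    have hne : (𝓝[<] TreeBroadcast.half).NeBot :=
      nhdsLT_neBot_of_exists_lt ⟨0, by
        rw [← Subtype.coe_lt_coe]; simp [TreeBroadcast.half]⟩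
    -- For every `δ < 1/2` the inner liminf is already `1/2 * l`.
    refine Tendsto.liminf_eq (tendsto_const_nhds.congr' ?_)
    filter_upwards [self_mem_nhdsWithin] with δ hδ
    have hδ' : (δ : ℝ) < 1 / 2 := hδ
    simp_rw [TreeBroadcast.integral_abs_noisyPosterior_sub_half, TreeBroadcast.integral_abs_Y]
    exact ((hY δ hδ').const_mul _).liminf_eq.symm
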